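/- Let $A$ be an abelian group. A subset $W \subseteq A$ is called a \emph{weak basis} of $A$ if $W$ generates $A$ and $w \notin \langle W \setminus \{w\}\rangle$ for every $w \in W$, where $\langle Y\rangle$ denotes the subgroup generated by $Y$. The group $A$ is called \emph{regularly weakly based} if every generating set of $A$ contains a weak basis of $A$. If $A$ is regularly weakly based, then there are abelian groups $F$ and $B$ such that $A \cong F \oplus B$, where $F$ is a finitely generated free abelian group and $nB = 0$ for some positive integer $n$. -/

import Mathlib

universe u

namespace WeaklyBased

variable (R : Type*) {M : Type*} [Ring R] [AddCommGroup M] [Module R M]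

/-- `X` is weakly independent over `Y`: no element `x` of `X` lies in the submodule generated by
`(X \ {x}) ∪ Y`. -/
def WeaklyIndependentOver (X Y : Set M) : Prop :=
  ∀ x ∈ X, x ∉ Submodule.span R ((X \ {x}) ∪ Y)

/-- `X` is weakly independent: it is weakly independent over the empty set. -/
def WeaklyIndependent (X : Set M) : Prop :=
  WeaklyIndependentOver R X ∅

/-- A weak basis of `M` is a weakly independent generating subset of `M`. -/
def IsWeakBasis (X : Set M) : Prop :=
  Submodule.span R X = ⊤ ∧ WeaklyIndependent R X

variable (M)

/-- `M` is regularly weakly based: every generating subset of `M` contains a weak basis of `M`. -/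
def RegularlyWeaklyBased : Prop :=
  ∀ X : Set M, Submodule.span R X = ⊤ → ∃ W : Set M, W ⊆ X ∧ IsWeakBasis R W

end WeaklyBased

/-! A generating set fails to contain a weak basis if it has a chain `x` whose terms are each
generated by any later one modulo a subgroup `F`, where infinitely many terms are always needed but
`F` is already spanned using only finitely many of them: any two suitable terms then make the
earlier redundant (`not_regularlyWeaklyBased_of_chain`).

Two chains of this kind carry the proof. Lifting elements of order p, p², ... from a Prüfer quotient
shows that no such quotient exists (`RegularlyWeaklyBased.not_surjective_quasiCyclic`); by
injectivity of the Prüfer group, p-parts of orders are then bounded modulo a finitely generated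
subgroup `F`, so A/F is torsion. Lifting partial sums of elements of orders powers of distinct
primes shows that only finitely many primes occur in A/F (`RegularlyWeaklyBased.finite_primes`).
Hence nA lies in `F` for some n ≠ 0, a further multiple NA is free of finite rank, and
multiplication by N splits off its kernel. -/

namespace WeaklyBased

/-! ### Prüfer groups: chain of subgroups, divisibility, injectivity -/

/-- The Prüfer group `ℤ(p^∞)`, as the `p`-primary component of `ℚ/ℤ`. -/
abbrev QuasiCyclic (p : ℕ) : Type :=
  Submodule.torsion' ℤ (AddCircle (1 : ℚ)) (Submonoid.powers (p : ℤ))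

namespace QuasiCyclic

variable {p : ℕ}

theorem exists_pow_smul_eq_zero (y : QuasiCyclic p) : ∃ k : ℕ, (p : ℤ) ^ k • y = 0 := by
  obtain ⟨y, hy⟩ := y
  obtain ⟨⟨_, k, rfl⟩, h⟩ := (Submodule.mem_torsion'_iff _ _).1 hy
  exact ⟨k, Subtype.ext h⟩

theorem eq_zero_of_isCoprime {m : ℤ} (hm : IsCoprime m p) {y : QuasiCyclic p}
    (h : m • y = 0) : y = 0 := by
  obtain ⟨k, hk⟩ := exists_pow_smul_eq_zero y
  obtain ⟨a, b, hab⟩ := hm.pow_right (n := k)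
  rw [← one_smul ℤ y, ← hab, add_smul, mul_smul, mul_smul, h, hk, smul_zero, smul_zero, add_zero]

/-- The subgroups of a Prüfer group form a chain: `z` has order at least p^(k+1), so it generates
everything killed by p^(k+1). -/
theorem exists_smul_eq_of_succ (hp : p.Prime) {k : ℕ} {y z : QuasiCyclic p}
    (hy : (p : ℤ) ^ (k + 1) • y = 0) (hz : (p : ℤ) ^ k • z ≠ 0) : ∃ s : ℤ, s • z = y := by
  obtain ⟨l, hl⟩ := exists_pow_smul_eq_zero z
  obtain ⟨y, hy'⟩ := y
  obtain ⟨z, hz'⟩ := z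
  have hy : (p : ℤ) ^ (k + 1) • y = 0 := congrArg Subtype.val hy
  have hl : (p : ℤ) ^ l • z = 0 := congrArg Subtype.val hl
  have hz : (p : ℤ) ^ k • z ≠ 0 := fun h => hz (Subtype.ext h)
  suffices ∃ s : ℤ, s • z = y by
    obtain ⟨s, hs⟩ := this
    exact ⟨s, Subtype.ext hs⟩
  have hl' : p ^ l • z = 0 := by exact_mod_cast hl
  obtain ⟨m, -, hm⟩ := (Nat.dvd_prime_pow hp).1 (addOrderOf_dvd_of_nsmul_eq_zero hl')
  have hkm : k + 1 ≤ m := by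
    by_contra! h
    apply hz
    have : p ^ k • z = 0 := addOrderOf_dvd_iff_nsmul_eq_zero.1 (hm ▸ pow_dvd_pow p (by omega))
    exact_mod_cast this
  have hpos : 0 < p ^ m := pow_pos hp.pos m
  have hy' : p ^ m • y = 0 := by
    obtain ⟨d, hd⟩ := pow_dvd_pow p hkm
    have : p ^ (k + 1) • y = 0 := by exact_mod_cast hy
    rw [hd, mul_comm, mul_smul, this, smul_zero]
  obtain ⟨a, -, ha, rfl⟩ := (AddCircle.addOrderOf_eq_pos_iff hpos).1 hm
  obtain ⟨j, -, rfl⟩ := (AddCircle.nsmul_eq_zero_iff hpos).1 hy'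
  -- Now z = a/p^m and y = j/p^m, with `s` inverse to `a` modulo p^m; thus (js)z and y differ by the
  -- integer -jv.
  obtain ⟨s, v, hsv⟩ := Nat.isCoprime_iff_coprime.2 (Nat.coprime_iff_gcd_eq_one.2 ha)
  refine ⟨j * s, ?_⟩
  rw [← AddCircle.coe_zsmul, ← sub_eq_zero, ← AddCircle.coe_sub, AddCircle.coe_eq_zero_iff]
  refine ⟨-(j * v), ?_⟩
  have hq : ((p ^ m : ℕ) : ℚ) ≠ 0 := by exact_mod_cast hpos.ne'
  have hsv' : (s : ℚ) * a + v * (p ^ m : ℕ) = 1 := by exact_mod_cast hsv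
  simp only [zsmul_eq_mul, Int.cast_neg, Int.cast_mul, Int.cast_natCast, mul_one]
  field_simp
  linear_combination (-j : ℚ) * hsv'

theorem exists_smul_eq (hp : p.Prime) {k : ℕ} {y z : QuasiCyclic p}
    (hy : (p : ℤ) ^ k • y = 0) (hz : (p : ℤ) ^ k • z ≠ 0) : ∃ s : ℤ, s • z = y :=
  exists_smul_eq_of_succ hp (by rw [pow_succ', mul_smul, hy, smul_zero]) hz

theorem baer (hp : p.Prime) : Module.Baer ℤ (QuasiCyclic p) := by
  have hdiv : ∀ {n : ℤ}, n ≠ 0 → ∀ y : QuasiCyclic p, ∃ w, n • w = y := by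
    intro n hn y
    obtain ⟨k, hk⟩ := exists_pow_smul_eq_zero y
    have hpI : Prime (p : ℤ) := Nat.prime_iff_prime_int.1 hp
    obtain ⟨n', hnn, hn'⟩ := (Int.finiteMultiplicity_iff.2
      ⟨by simpa using hp.ne_one, hn⟩ : FiniteMultiplicity (p : ℤ) n).exists_eq_pow_mul_and_not_dvd
    generalize multiplicity (p : ℤ) n = a at hnn
    subst hnn
    have hpa : (p : ℤ) ^ a ≠ 0 := pow_ne_zero _ hpI.ne_zero
    have hz : (p : ℤ) ^ a • DivisibleBy.div (y : AddCircle (1 : ℚ)) ((p : ℤ) ^ a) = y :=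
      DivisibleBy.div_cancel _ hpa
    set z := DivisibleBy.div (y : AddCircle (1 : ℚ)) ((p : ℤ) ^ a)
    have hkz : (p : ℤ) ^ (k + a) • z = 0 := by
      rw [pow_add, mul_smul, hz]
      exact congrArg Subtype.val hk
    -- The factor p^a was divided out in ℚ/ℤ; the prime-to-p factor `n'` is invertible modulo the
    -- exponent p^(k+a) of `z`.
    obtain ⟨u, v, huv⟩ := ((hpI.coprime_iff_not_dvd.2 hn').symm.pow_right (n := k + a))
    refine ⟨u • ⟨z, (Submodule.mem_torsion'_iff _ _).2 ⟨⟨_, k + a, rfl⟩, hkz⟩⟩, Subtype.ext ?_⟩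
    change ((p : ℤ) ^ a * n') • u • z = y
    have : u * n' = 1 - v * (p : ℤ) ^ (k + a) := by linear_combination huv
    rw [mul_smul, smul_smul n', mul_comm n', this, sub_smul, mul_smul, hkz, smul_zero, one_smul,
      sub_zero, hz]
  have : DivisibleBy (QuasiCyclic p) ℤ := divisibleByOfSMulRightSurj _ _ fun hn y => hdiv hn y
  exact Module.Baer.of_divisible _

theorem exists_order (hp : p.Prime) (k : ℕ) : ∃ c : QuasiCyclic p,
    (p : ℤ) ^ k • c ≠ 0 ∧ ∀ m : ℤ, (p : ℤ) ^ (k + 1) ∣ m → m • c = 0 := by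
  have hpos : 0 < p ^ (k + 1) := pow_pos hp.pos _
  have ho := AddCircle.addOrderOf_period_div (p := (1 : ℚ)) hpos
  set c : AddCircle (1 : ℚ) := ↑((1 : ℚ) / (p ^ (k + 1) : ℕ)) with hc
  have h0 : (p : ℤ) ^ (k + 1) • c = 0 := by
    have := addOrderOf_nsmul_eq_zero c
    rw [ho] at this
    exact_mod_cast this
  refine ⟨⟨c, (Submodule.mem_torsion'_iff _ _).2 ⟨⟨_, k + 1, rfl⟩, h0⟩⟩, ?_, ?_⟩
  · intro h
    have h : (p : ℤ) ^ k • c = 0 := congrArg Subtype.val h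
    have h : p ^ k • c = 0 := by exact_mod_cast h
    have := addOrderOf_dvd_of_nsmul_eq_zero h
    rw [ho, Nat.pow_dvd_pow_iff_le_right hp.one_lt] at this
    omega
  · rintro _ ⟨d, rfl⟩
    apply Subtype.ext
    change _ • c = 0
    rw [mul_comm, mul_smul, h0, smul_zero]

/-- A linear map to the Prüfer group that is not bounded by a power of `p` is surjective. -/
theorem surjective_of_unbounded (hp : p.Prime) {A : Type*} [AddCommGroup A]
    {χ : A →ₗ[ℤ] QuasiCyclic p} (h : ∀ k : ℕ, ∃ t, (p : ℤ) ^ k • χ t ≠ 0) :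
    Function.Surjective χ := by
  intro y
  obtain ⟨k, hk⟩ := exists_pow_smul_eq_zero y
  obtain ⟨t, ht⟩ := h k
  obtain ⟨s, hs⟩ := exists_smul_eq hp hk ht
  exact ⟨s • t, by rw [map_smul, hs]⟩

theorem exists_linearMap (hp : p.Prime) {A : Type*} [AddCommGroup A] (t : A) (c : QuasiCyclic p)
    (h : ∀ m : ℤ, m • t = 0 → m • c = 0) : ∃ ψ : A →ₗ[ℤ] QuasiCyclic p, ψ t = c := by
  let f := LinearMap.toSpanSingleton ℤ A t
  have hker : LinearMap.ker f ≤ LinearMap.ker (LinearMap.toSpanSingleton ℤ (QuasiCyclic p) c) := by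
    intro m hm
    rw [LinearMap.mem_ker, LinearMap.toSpanSingleton_apply] at hm ⊢
    exact h m hm
  obtain ⟨ψ, hψ⟩ := (baer hp).extension_property ((LinearMap.ker f).liftQ f le_rfl)
    (LinearMap.ker_eq_bot.1 (Submodule.ker_liftQ_eq_bot' _ f rfl))
    ((LinearMap.ker f).liftQ (LinearMap.toSpanSingleton ℤ _ c) hker)
  refine ⟨ψ, ?_⟩
  have := LinearMap.congr_fun hψ (Submodule.Quotient.mk 1)
  rw [LinearMap.comp_apply, Submodule.liftQ_apply, Submodule.liftQ_apply] at this
  simpa only [f, LinearMap.toSpanSingleton_apply, one_smul] using this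

end QuasiCyclic
end WeaklyBased

/-! ### Redundant chains and the exclusion of Prüfer quotients -/

namespace WeaklyBased

section Chains

variable {A : Type*} [AddCommGroup A]

open Submodule

/-- A criterion for failing to be regularly weakly based: modulo a submodule `F` that is generated
by an essentially disjoint part of every generating subset, the generating set `range x ∪ L`
contains an ascending chain `x` that is needed cofinally but never minimally. -/
theorem not_regularlyWeaklyBased_of_chain {x : ℕ → A} {L : Set A} {F : Submodule ℤ A}
    (hchain : ∀ i j, i ≤ j → x i ∈ span ℤ {x j} ⊔ F)
    (hgen : span ℤ (Set.range x ∪ L) = ⊤)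
    (hfin : ∀ n, span ℤ (x '' Set.Iio n ∪ L) ≠ ⊤)
    (hF : ∀ W ⊆ Set.range x ∪ L, span ℤ W = ⊤ →
      ∃ W₀ ⊆ W, F ≤ span ℤ W₀ ∧ (W₀ ∩ Set.range x).Finite) :
    ¬ RegularlyWeaklyBased ℤ A := by
  intro hA
  obtain ⟨W, hWX, hWgen, hWind⟩ := hA _ hgen
  obtain ⟨W₀, hW₀, hFW, hW₀fin⟩ := hF W hWX hWgen
  -- By `hfin`, `W` must use chain elements outside every finite set.
  have key : ∀ S : Set A, S.Finite → ∃ i, x i ∈ W ∧ x i ∉ S := by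
    intro S hS
    by_contra! h
    have : ∃ n, S ∩ Set.range x ⊆ x '' Set.Iio n := by
      have hfin : (S ∩ Set.range x).Finite := hS.inter_of_left _
      choose! f hf using fun a (ha : a ∈ S ∩ Set.range x) => ha.2
      obtain ⟨n, hn⟩ := (hfin.image f).bddAbove
      exact ⟨n + 1, fun a ha => ⟨f a, Nat.lt_succ_of_le (hn ⟨a, ha, rfl⟩), hf a ha⟩⟩
    obtain ⟨n, hn⟩ := this
    refine hfin n (eq_top_iff.2 (hWgen ▸ span_mono ?_))
    intro w hw
    rcases hWX hw with ⟨i, rfl⟩ | hL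
    · exact Or.inl (hn ⟨h i hw, i, rfl⟩)
    · exact Or.inr hL
  obtain ⟨i, hiW, hi⟩ := key _ hW₀fin
  have hi₀ : x i ∉ W₀ := fun h => hi ⟨h, i, rfl⟩
  -- Values rather than indices are avoided, since `x` may repeat: this gives both i ≤ j and x j ≠ x
  -- i.
  obtain ⟨j, hjW, hj⟩ := key (x '' Set.Iic i) ((Set.finite_Iic i).image x)
  have hij : i ≤ j := by
    by_contra! h
    exact hj ⟨j, h.le, rfl⟩
  have hne : x j ≠ x i := fun h => hj ⟨i, Set.self_mem_Iic, h.symm⟩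
  refine hWind _ hiW ((sup_le ?_ ?_ : span ℤ {x j} ⊔ F ≤ _) (hchain i j hij))
  · rw [span_singleton_le_iff_mem]
    exact subset_span (Or.inl ⟨hjW, hne⟩)
  · refine hFW.trans (span_mono fun w hw => Or.inl ⟨hW₀ hw, ?_⟩)
    rintro rfl
    exact hi₀ hw

theorem mem_span_zmod_iff {p : ℕ} [Module (ZMod p) A] {s : Set A} {z : A} :
    z ∈ span (ZMod p) s ↔ z ∈ span ℤ s := by
  constructor
  · intro hz
    exact (span_le (p := AddSubgroup.toZModSubmodule p (span ℤ s).toAddSubgroup)).2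
      subset_span hz
  · intro hz
    exact (span_le (p := AddSubgroup.toIntSubmodule (span (ZMod p) s).toAddSubgroup)).2
      subset_span hz

/-- Since `K` maps onto A/pA, an 𝔽_p-basis of A/pA can be chosen in its image and lifted bijectively
to `K`. -/
theorem exists_basis_mod_prime {p : ℕ} (hp : p.Prime) {K : Submodule ℤ A}
    (hK : ∀ a : A, ∃ k ∈ K, ∃ b : A, a = k + (p : ℤ) • b) :
    ∃ Y ⊆ (K : Set A), (∀ a : A, ∃ k ∈ span ℤ Y, ∃ b : A, a = k + (p : ℤ) • b) ∧
      ∀ y ∈ Y, y ∉ span ℤ (Y \ {y}) ⊔ LinearMap.range (LinearMap.lsmul ℤ A (p : ℤ)) := by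
  have : Fact p.Prime := ⟨hp⟩
  set R := LinearMap.range (LinearMap.lsmul ℤ A (p : ℤ)) with hR
  let : Module (ZMod p) (A ⧸ R) := AddCommGroup.zmodModule fun x => by
    obtain ⟨a, rfl⟩ := R.mkQ_surjective x
    rw [← map_nsmul, ← LinearMap.mem_ker, ker_mkQ]
    exact ⟨a, by simp⟩
  obtain ⟨b, hbK, hbspan, hbind⟩ := exists_linearIndependent (ZMod p) (R.mkQ '' K)
  obtain ⟨Y, hYK, hYbij⟩ := Set.exists_subset_bijOn ((K : Set A) ∩ R.mkQ ⁻¹' b) R.mkQ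
  have hYb : R.mkQ '' Y = b := by
    rw [hYbij.image_eq, Set.image_inter_preimage, Set.inter_eq_right]
    exact hbK
  have hspan := fun s (z : A ⧸ R) => mem_span_zmod_iff (p := p) (s := s) (z := z)
  refine ⟨Y, fun y hy => (hYK hy).1, fun a => ?_, fun y hy hmem => ?_⟩
  · obtain ⟨k, hk, c, hc⟩ := hK a
    have hkb : R.mkQ k ∈ (span ℤ Y).map R.mkQ := by
      rw [map_span, hYb, ← hspan, hbspan]
      exact subset_span ⟨k, hk, rfl⟩
    obtain ⟨l, hl, hlk⟩ := hkb
    have : k - l ∈ R := by rw [← ker_mkQ R, LinearMap.mem_ker, map_sub, hlk, sub_self]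
    obtain ⟨d, hd⟩ := this
    refine ⟨l, hl, d + c, ?_⟩
    rw [LinearMap.lsmul_apply] at hd
    rw [smul_add, hd, hc]
    abel
  · have hyb : R.mkQ y ∈ b := hYb ▸ ⟨y, hy, rfl⟩
    refine LinearIndepOn.notMem_span (v := id) hbind hyb ?_
    have : R.mkQ y ∈ (span ℤ (Y \ {y}) ⊔ R).map R.mkQ := mem_map_of_mem hmem
    rw [Submodule.map_sup, mkQ_map_self, sup_bot_eq, map_span, ← hspan] at this
    refine span_mono ?_ this
    rintro _ ⟨z, ⟨hzY, hzy⟩, rfl⟩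
    exact ⟨_, ⟨hYb ▸ ⟨z, hzY, rfl⟩, fun h => hzy (hYbij.injOn hzY hy h)⟩, rfl⟩

/-- Prüfer groups are not quotients of regularly weakly based groups. -/
theorem RegularlyWeaklyBased.not_surjective_quasiCyclic (hA : RegularlyWeaklyBased ℤ A) {p : ℕ}
    (hp : p.Prime) (χ : A →ₗ[ℤ] QuasiCyclic p) : ¬ Function.Surjective χ := by
  intro hχ
  have hpdiv : ∀ y : QuasiCyclic p, ∃ a : A, (p : ℤ) • χ a = y := by
    intro y
    obtain ⟨k, hk⟩ := QuasiCyclic.exists_pow_smul_eq_zero y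
    obtain ⟨c, hc, -⟩ := QuasiCyclic.exists_order hp (k + 1)
    rw [pow_succ, mul_smul] at hc
    obtain ⟨s, hs⟩ := QuasiCyclic.exists_smul_eq hp hk hc
    obtain ⟨a, ha⟩ := hχ (s • c)
    exact ⟨a, by rw [ha, smul_comm, hs]⟩
  set K := LinearMap.ker χ with hKdef
  obtain ⟨Y, hYK, hYgen, hYind⟩ := exists_basis_mod_prime hp (K := K) (by
    intro a
    obtain ⟨b, hb⟩ := hpdiv (χ a)
    exact ⟨a - (p : ℤ) • b, by
      rw [hKdef, LinearMap.mem_ker, map_sub, map_smul, hb, sub_self], b, by abel⟩)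
  set R := LinearMap.range (LinearMap.lsmul ℤ A (p : ℤ)) with hR
  have hmemR : ∀ a, a ∈ R ↔ ∃ b, (p : ℤ) • b = a := fun a => by simp [hR]
  have hspanYK : span ℤ Y ≤ K := span_le.2 hYK
  obtain ⟨c, hc, hpc⟩ := QuasiCyclic.exists_order hp 0
  rw [pow_zero, one_smul] at hc
  replace hpc : (p : ℤ) • c = 0 := hpc _ (by simp)
  obtain ⟨a₀, ha₀⟩ := hpdiv c
  -- Keeping the chain inside pA is what later forces every generating subset to contain `Y`.
  have hstep : ∀ a : R, ∃ b : R, (a : A) - (p : ℤ) • (b : A) ∈ span ℤ Y := by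
    rintro ⟨_, a, rfl⟩
    obtain ⟨k, hk, b, hab⟩ := hYgen a
    refine ⟨⟨(p : ℤ) • b, b, rfl⟩, ?_⟩
    have : (p : ℤ) • a - (p : ℤ) • (p : ℤ) • b = (p : ℤ) • k := by rw [hab, smul_add]; abel
    exact this ▸ smul_mem _ _ hk
  choose g hg using hstep
  let xs : ℕ → R := fun n => g^[n] ⟨(p : ℤ) • a₀, a₀, rfl⟩
  let x : ℕ → A := fun n => xs n
  have hxs : ∀ n, x n - (p : ℤ) • x (n + 1) ∈ span ℤ Y := by
    intro n
    simp only [x, xs, Function.iterate_succ_apply']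
    exact hg _
  have hpow : ∀ n d, x n - (p : ℤ) ^ d • x (n + d) ∈ span ℤ Y := by
    intro n d
    induction d with
    | zero => simp
    | succ d ih =>
      have := add_mem ih (smul_mem _ ((p : ℤ) ^ d) (hxs (n + d)))
      rw [smul_sub, smul_smul, ← pow_succ] at this
      convert this using 1
      rw [add_assoc]; abel
  -- As `c` has order p, χ(x n) has order exactly p^(n+1).
  have hχx : ∀ n, (p : ℤ) ^ n • χ (x n) = c := by
    intro n
    have : x 0 - (p : ℤ) ^ n • x n ∈ K := by simpa using hspanYK (hpow 0 n)
    rw [hKdef, LinearMap.mem_ker, map_sub, map_smul, sub_eq_zero] at this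
    rw [← this, ← ha₀]
    simp [x, xs]
  have hx0 : ∀ n, x n ∉ K := by
    intro n h
    apply hc
    rw [← hχx n, LinearMap.mem_ker.1 h, smul_zero]
  refine not_regularlyWeaklyBased_of_chain (x := x) (L := Y ∪ (K ⊓ R : Submodule ℤ A))
    (F := span ℤ Y) ?_ ?_ ?_ ?_ hA
  · intro i j hij
    obtain ⟨d, rfl⟩ := Nat.exists_eq_add_of_le hij
    rw [← sub_add_cancel (x i) ((p : ℤ) ^ d • x (i + d)), add_comm (x i - _)]
    exact add_mem_sup (smul_mem _ _ (mem_span_singleton_self _)) (hpow i d)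
  · rw [eq_top_iff]
    rintro a -
    obtain ⟨n, hn⟩ := QuasiCyclic.exists_pow_smul_eq_zero (χ a)
    have hn' : (p : ℤ) ^ n • χ (x n) ≠ 0 := by rwa [hχx]
    obtain ⟨s, hs⟩ := QuasiCyclic.exists_smul_eq hp hn hn'
    have haK : a - s • x n ∈ K := by simp [hKdef, hs]
    obtain ⟨k, hk, b, hab⟩ := hYgen (a - s • x n)
    rw [← sub_add_cancel a (s • x n), hab]
    refine add_mem (add_mem (span_mono (fun y hy => Or.inr (Or.inl hy)) hk)
      (subset_span (Or.inr (Or.inr ⟨?_, b, rfl⟩)))) (smul_mem _ _ (subset_span (Or.inl ⟨n, rfl⟩)))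
    rw [← add_sub_cancel_left k ((p : ℤ) • b), ← hab]
    exact sub_mem haK (hspanYK hk)
  · intro n h
    obtain ⟨d, hd, -⟩ := QuasiCyclic.exists_order hp n
    obtain ⟨a, rfl⟩ := hχ d
    apply hd
    have : (⊤ : Submodule ℤ A) ≤ LinearMap.ker ((p : ℤ) ^ n • χ) := by
      rw [← h, span_le]
      rintro _ (⟨i, hi, rfl⟩ | hw | hw)
      · obtain ⟨e, rfl⟩ := Nat.exists_eq_add_of_lt hi
        rw [SetLike.mem_coe, LinearMap.mem_ker, LinearMap.smul_apply, pow_add, pow_one, pow_add,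
          mul_assoc, mul_comm, mul_smul, mul_smul, smul_comm (_ ^ e), smul_comm (_ ^ e),
          smul_comm (_ ^ i), hχx, smul_comm (p : ℤ), hpc, smul_zero]
      · exact LinearMap.mem_ker.2 (by rw [LinearMap.smul_apply, hYK hw, smul_zero])
      · exact LinearMap.mem_ker.2 (by rw [LinearMap.smul_apply, hw.1, smul_zero])
    exact this mem_top
  · intro W hW hWgen
    -- All generators outside `Y` vanish in A/pA, where `Y` is a basis; none of its elements can be
    -- dropped.
    have hYW : Y ⊆ W := by
      intro y hy
      by_contra hyW
      apply hYind y hy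
      have : span ℤ W ≤ span ℤ (Y \ {y}) ⊔ R := by
        rw [span_le]
        intro w hw
        rcases hW hw with ⟨i, rfl⟩ | h | h
        · exact mem_sup_right (xs i).2
        · exact mem_sup_left (subset_span ⟨h, fun h' => hyW (h' ▸ hw)⟩)
        · exact mem_sup_right h.2
      exact this (hWgen ▸ mem_top)
    refine ⟨Y, hYW, le_rfl, ?_⟩
    convert Set.finite_empty
    rw [Set.eq_empty_iff_forall_notMem]
    rintro _ ⟨hy, i, rfl⟩
    exact hx0 i (hYK hy)

end Chains
end WeaklyBased

/-! ### Constructing Prüfer quotients from unbounded orders -/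

namespace WeaklyBased

section Extension

variable {A : Type*} [AddCommGroup A] {p : ℕ}

open Submodule

/-- If `χ` itself fails at `t`, correct it by a map that factors through A/S; the divisibility
hypothesis lets the image of `t` there go to an element of order p^(k+1). -/
theorem QuasiCyclic.exists_extension_ne_zero (hp : p.Prime) (S : Submodule ℤ A)
    (χ : A →ₗ[ℤ] QuasiCyclic p) {k : ℕ} {t : A} (ht : ∀ m : ℤ, m • t ∈ S → (p : ℤ) ^ (k + 1) ∣ m) :
    ∃ χ' : A →ₗ[ℤ] QuasiCyclic p, (∀ s ∈ S, χ' s = χ s) ∧ (p : ℤ) ^ k • χ' t ≠ 0 := by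
  by_cases h : (p : ℤ) ^ k • χ t = 0
  · obtain ⟨c, hc, hc'⟩ := QuasiCyclic.exists_order hp k
    obtain ⟨ψ, hψ⟩ := QuasiCyclic.exists_linearMap hp (S.mkQ t) c fun m hm =>
      hc' m (ht m (by rwa [← map_smul, ← LinearMap.mem_ker, ker_mkQ] at hm))
    refine ⟨χ + ψ ∘ₗ S.mkQ, fun s hs => ?_, ?_⟩
    · have : S.mkQ s = 0 := by rwa [← LinearMap.mem_ker, ker_mkQ]
      rw [LinearMap.add_apply, LinearMap.comp_apply, this, map_zero, add_zero]
    · rwa [LinearMap.add_apply, LinearMap.comp_apply, hψ, smul_add, h, zero_add]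
  · exact ⟨χ, fun _ _ => rfl, h⟩

/-- Compatible linear maps into a Baer module glue along an increasing sequence of submodules. -/
theorem exists_linearMap_of_compatible {Q : Type*} [AddCommGroup Q] (hQ : Module.Baer ℤ Q)
    {S : ℕ → Submodule ℤ A} (hS : Monotone S) {χ : ℕ → A →ₗ[ℤ] Q}
    (hχ : ∀ n, ∀ s ∈ S n, χ (n + 1) s = χ n s) :
    ∃ φ : A →ₗ[ℤ] Q, ∀ n, ∀ s ∈ S n, φ s = χ n s := by
  have hcompat : ∀ m n, m ≤ n → ∀ s ∈ S m, χ n s = χ m s := by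
    intro m n hmn s hs
    induction n, hmn using Nat.le_induction with
    | base => rfl
    | succ n hmn ih => rw [hχ n s (hS hmn hs), ih]
  have hmem : ∀ u : (⨆ n, S n : Submodule ℤ A), ∃ n, (u : A) ∈ S n := fun u =>
    (mem_iSup_of_directed S hS.directed_le).1 u.2
  choose N hN using hmem
  have hval : ∀ (u : (⨆ n, S n : Submodule ℤ A)) n, (u : A) ∈ S n → χ (N u) u = χ n u := by
    intro u n hu
    rcases le_total n (N u) with h | h
    · exact hcompat _ _ h _ hu
    · exact (hcompat _ _ h _ (hN u)).symm
  let f : (⨆ n, S n : Submodule ℤ A) →+ Q := AddMonoidHom.mk' (fun u => χ (N u) u) (by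
    intro a b
    have ha := hS (le_max_left (N a) (N b)) (hN a)
    have hb := hS (le_max_right (N a) (N b)) (hN b)
    rw [hval a _ ha, hval b _ hb, hval (a + b) _ (add_mem ha hb), coe_add, map_add])
  obtain ⟨φ, hφ⟩ := hQ.extension_property (⨆ n, S n : Submodule ℤ A).subtype
    (subtype_injective _) f.toIntLinearMap
  refine ⟨φ, fun n s hs => ?_⟩
  have hs' : s ∈ (⨆ n, S n : Submodule ℤ A) := mem_iSup_of_mem n hs
  exact (LinearMap.congr_fun hφ ⟨s, hs'⟩).trans (hval ⟨s, hs'⟩ n hs)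

/-- If the `p`-parts of the orders of elements stay unbounded modulo every finitely generated
subgroup, then the Prüfer group is a quotient. -/
theorem QuasiCyclic.exists_surjective (hp : p.Prime)
    (h : ∀ S : Submodule ℤ A, S.FG → ∀ k : ℕ, ∃ t : A, ∀ m : ℤ, m • t ∈ S → (p : ℤ) ^ k ∣ m) :
    ∃ χ : A →ₗ[ℤ] QuasiCyclic p, Function.Surjective χ := by
  have step : ∀ (k : ℕ) (s : {S : Submodule ℤ A // S.FG} × (A →ₗ[ℤ] QuasiCyclic p)),
      ∃ s' : {S : Submodule ℤ A // S.FG} × (A →ₗ[ℤ] QuasiCyclic p),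
        s.1.1 ≤ s'.1.1 ∧ (∀ a ∈ s.1.1, s'.2 a = s.2 a) ∧
          ∃ t ∈ s'.1.1, (p : ℤ) ^ k • s'.2 t ≠ 0 := by
    rintro k ⟨⟨S, hS⟩, χ⟩
    obtain ⟨t, ht⟩ := h S hS (k + 1)
    obtain ⟨χ', hχ', hne⟩ := exists_extension_ne_zero hp S χ ht
    exact ⟨⟨⟨S ⊔ span ℤ {t}, hS.sup (fg_span_singleton t)⟩, χ'⟩, le_sup_left, hχ', t,
      mem_sup_right (mem_span_singleton_self t), hne⟩
  choose g hg₁ hg₂ hg₃ using step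
  let s : ℕ → {S : Submodule ℤ A // S.FG} × (A →ₗ[ℤ] QuasiCyclic p) :=
    fun n => Nat.rec ⟨⟨⊥, fg_bot⟩, 0⟩ g n
  obtain ⟨φ, hφ⟩ := exists_linearMap_of_compatible (baer hp) (S := fun n => (s n).1.1)
    (χ := fun n => (s n).2) (monotone_nat_of_le_succ fun n => hg₁ n (s n)) fun n => hg₂ n (s n)
  refine ⟨φ, surjective_of_unbounded hp fun k => ?_⟩
  obtain ⟨t, ht, hne⟩ := hg₃ k (s k)
  exact ⟨t, by rwa [hφ (k + 1) t ht]⟩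

/-- Modulo a suitable finitely generated subgroup, the `p`-parts of the orders of the elements of a
regularly weakly based group are bounded. -/
theorem RegularlyWeaklyBased.exists_fg_bound (hA : RegularlyWeaklyBased ℤ A) (hp : p.Prime) :
    ∃ S : Submodule ℤ A, S.FG ∧ ∃ k : ℕ, ∀ t : A, ∃ m : ℤ, m • t ∈ S ∧ ¬ (p : ℤ) ^ k ∣ m := by
  by_contra! h
  obtain ⟨χ, hχ⟩ := QuasiCyclic.exists_surjective hp h
  exact hA.not_surjective_quasiCyclic hp χ hχ

theorem exists_smul_eq_zero_of_fg_torsion {S : Submodule ℤ A} (hS : S.FG)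
    (htors : ∀ t ∈ S, ∃ m : ℤ, m ≠ 0 ∧ m • t = 0) : ∃ e : ℤ, e ≠ 0 ∧ ∀ t ∈ S, e • t = 0 := by
  induction S, hS using fg_induction with
  | singleton x =>
    obtain ⟨m, hm, h⟩ := htors x (mem_span_singleton_self x)
    refine ⟨m, hm, fun t ht => ?_⟩
    obtain ⟨s, rfl⟩ := mem_span_singleton.1 ht
    rw [smul_comm, h, smul_zero]
  | sup M₁ M₂ _ _ h₁ h₂ =>
    obtain ⟨a, ha, ha'⟩ := h₁ fun t ht => htors t (mem_sup_left ht)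
    obtain ⟨b, hb, hb'⟩ := h₂ fun t ht => htors t (mem_sup_right ht)
    refine ⟨a * b, mul_ne_zero ha hb, fun t ht => ?_⟩
    obtain ⟨x, hx, y, hy, rfl⟩ := mem_sup.1 ht
    rw [smul_add, mul_smul, smul_comm, ha' x hx, smul_zero, mul_smul, hb' y hy, smul_zero, add_zero]

/-- In a torsion group without Prüfer quotients, the `p`-parts of the orders are bounded. -/
theorem exists_not_pow_dvd_addOrderOf (hp : p.Prime) (htors : ∀ t : A, ∃ m : ℤ, m ≠ 0 ∧ m • t = 0)
    (hA : ∀ χ : A →ₗ[ℤ] QuasiCyclic p, ¬ Function.Surjective χ) :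
    ∃ k : ℕ, ∀ t : A, ¬ p ^ k ∣ addOrderOf t := by
  have : ∃ S : Submodule ℤ A, S.FG ∧ ∃ k : ℕ, ∀ t : A, ∃ m : ℤ, m • t ∈ S ∧ ¬ (p : ℤ) ^ k ∣ m := by
    by_contra! h
    obtain ⟨χ, hχ⟩ := QuasiCyclic.exists_surjective hp h
    exact hA χ hχ
  obtain ⟨S, hS, k, hk⟩ := this
  obtain ⟨e, he, heS⟩ := exists_smul_eq_zero_of_fg_torsion hS fun t _ => htors t
  have hpI : Prime (p : ℤ) := Nat.prime_iff_prime_int.1 hp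
  obtain ⟨c, hc, hc'⟩ := (Int.finiteMultiplicity_iff.2 ⟨by simpa using hp.ne_one, he⟩ :
    FiniteMultiplicity (p : ℤ) e).exists_eq_pow_mul_and_not_dvd
  generalize multiplicity (p : ℤ) e = a at hc
  refine ⟨k + a, fun t ht => ?_⟩
  obtain ⟨m, hm, hmk⟩ := hk t
  have h₁ : (addOrderOf t : ℤ) ∣ e * m :=
    addOrderOf_dvd_iff_zsmul_eq_zero.2 (by rw [mul_smul, heS _ hm])
  -- Only the factor p^a of the exponent `e` of `S` can be lost in passing from A to A/S.
  have h₂ : (p : ℤ) ^ a * p ^ k ∣ (p : ℤ) ^ a * (c * m) := by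
    rw [← mul_assoc, ← hc, ← pow_add, add_comm]
    exact dvd_trans (by exact_mod_cast ht) h₁
  exact hmk (((hpI.coprime_iff_not_dvd.2 hc').pow_left).dvd_of_dvd_mul_left
    ((mul_dvd_mul_iff_left (pow_ne_zero a hpI.ne_zero)).1 h₂))

end Extension
end WeaklyBased

/-! ### Finiteness of the set of primes, and bounded quotients -/

namespace WeaklyBased

section Torsion

variable {A : Type*} [AddCommGroup A]

open Submodule

/-- A torsion group with `p`-torsion but without Prüfer quotients is, modulo a subgroup containing
all elements of order prime to `p`, a nontrivial cyclic group generated by an element of `p`-power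
order. -/
theorem exists_cyclic_quotient {p : ℕ} (hp : p.Prime)
    (htors : ∀ t : A, ∃ m : ℤ, m ≠ 0 ∧ m • t = 0)
    (hA : ∀ χ : A →ₗ[ℤ] QuasiCyclic p, ¬ Function.Surjective χ) {t₀ : A} (ht₀ : addOrderOf t₀ = p) :
    ∃ (K : Submodule ℤ A) (u : A) (j : ℕ), (p : ℤ) ^ j • u = 0 ∧ u ∉ K ∧
      (∀ a, ∃ c : ℤ, a - c • u ∈ K) ∧ ∀ (m : ℤ) (t : A), IsCoprime m p → m • t = 0 → t ∈ K := by
  obtain ⟨c, hc, hc'⟩ := QuasiCyclic.exists_order hp 0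
  obtain ⟨f, hf⟩ := QuasiCyclic.exists_linearMap hp t₀ c fun m hm => hc' m (by
    rw [zero_add, pow_one, ← ht₀]
    exact addOrderOf_dvd_iff_zsmul_eq_zero.2 hm)
  have hbdd : ∃ k : ℕ, ∀ t, (p : ℤ) ^ k • f t = 0 := by
    by_contra! h
    exact hA f (QuasiCyclic.surjective_of_unbounded hp h)
  classical
  obtain ⟨k, hk⟩ : ∃ k, Nat.find hbdd = k + 1 := by
    refine Nat.exists_eq_succ_of_ne_zero fun h => hc ?_
    rw [← hf]
    exact (Nat.find_eq_zero hbdd).1 h t₀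
  have hk₁ := Nat.find_spec hbdd
  rw [hk] at hk₁
  have hk₂ := Nat.find_min hbdd (m := k) (by omega)
  push Not at hk₂
  obtain ⟨u, hu⟩ := hk₂
  obtain ⟨m, hm, hmu⟩ := htors u
  have hpI : Prime (p : ℤ) := Nat.prime_iff_prime_int.1 hp
  obtain ⟨d, hd, hd'⟩ := (Int.finiteMultiplicity_iff.2 ⟨by simpa using hp.ne_one, hm⟩ :
    FiniteMultiplicity (p : ℤ) m).exists_eq_pow_mul_and_not_dvd
  have hdp := (hpI.coprime_iff_not_dvd.2 hd').symm
  generalize multiplicity (p : ℤ) m = j at hd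
  -- Multiplying by the prime-to-p part `d` of `m` makes the order of `u` a power of p without
  -- shrinking the subgroup generated by its image.
  have hdu : (p : ℤ) ^ k • f (d • u) ≠ 0 := by
    rw [map_smul, smul_comm]
    exact fun h => hu (QuasiCyclic.eq_zero_of_isCoprime hdp h)
  refine ⟨LinearMap.ker f, d • u, j, by rw [smul_smul, ← hd, hmu], fun h => ?_, fun a => ?_,
    fun m t hmp hmt => ?_⟩
  · exact hdu (by rw [LinearMap.mem_ker.1 h, smul_zero])
  · obtain ⟨s, hs⟩ := QuasiCyclic.exists_smul_eq_of_succ hp (hk₁ a) hdu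
    exact ⟨s, by rw [LinearMap.mem_ker, map_sub, map_smul, hs, sub_self]⟩
  · exact QuasiCyclic.eq_zero_of_isCoprime hmp (by rw [← map_smul, hmt, map_zero])

/-- The product `M` of the other prime powers kills all summands but `u i`, on which it acts
invertibly. -/
theorem mem_span_sum_of_coprime {q : ℕ → ℕ} (hq : ∀ i, (q i).Prime) (hinj : Function.Injective q)
    {u : ℕ → A} {j : ℕ → ℕ} (hu : ∀ i, (q i : ℤ) ^ j i • u i = 0) {s : Finset ℕ} {i : ℕ}
    (hi : i ∈ s) : u i ∈ span ℤ {∑ l ∈ s, u l} := by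
  set M : ℤ := ∏ l ∈ s.erase i, (q l : ℤ) ^ j l with hM
  have hcop : IsCoprime M ((q i : ℤ) ^ j i) := IsCoprime.prod_left fun l hl => IsCoprime.pow
    (Nat.isCoprime_iff_coprime.2 ((Nat.coprime_primes (hq l) (hq i)).2
      (hinj.ne (Finset.ne_of_mem_erase hl))))
  have hMu : M • ∑ l ∈ s, u l = M • u i := by
    rw [Finset.smul_sum]
    refine Finset.sum_eq_single_of_mem i hi fun l hl hli => ?_
    obtain ⟨d, hd⟩ := Finset.dvd_prod_of_mem (fun l => (q l : ℤ) ^ j l)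
      (Finset.mem_erase.2 ⟨hli, hl⟩)
    rw [hM, hd, mul_comm, mul_smul, hu, smul_zero]
  obtain ⟨a, b, hab⟩ := hcop
  rw [← one_smul ℤ (u i), ← hab, add_smul, mul_smul, ← hMu, mul_smul b, hu, smul_zero, add_zero]
  exact smul_mem _ _ (smul_mem _ _ (mem_span_singleton_self _))

/-- A regularly weakly based group has only finitely many relevant primes modulo a finitely
generated subgroup with torsion quotient. -/
theorem RegularlyWeaklyBased.finite_primes (hA : RegularlyWeaklyBased ℤ A) {F : Submodule ℤ A}
    (hF : F.FG) (htors : ∀ t : A ⧸ F, ∃ m : ℤ, m ≠ 0 ∧ m • t = 0) :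
    {p : ℕ | p.Prime ∧ ∃ t : A ⧸ F, p ∣ addOrderOf t}.Finite := by
  by_contra hinf
  let e := Set.Infinite.natEmbedding _ hinf
  set q : ℕ → ℕ := fun i => e i with hqdef
  have hinj : Function.Injective q := Subtype.val_injective.comp e.injective
  have hq : ∀ i, (q i).Prime := fun i => (e i).2.1
  have hdata : ∀ i, ∃ (K : Submodule ℤ (A ⧸ F)) (u : A ⧸ F) (j : ℕ), (q i : ℤ) ^ j • u = 0 ∧
      u ∉ K ∧ (∀ a, ∃ c : ℤ, a - c • u ∈ K) ∧
      ∀ (m : ℤ) (t : A ⧸ F), IsCoprime m (q i) → m • t = 0 → t ∈ K := by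
    intro i
    obtain ⟨t, d, hd⟩ := (e i).2.2
    have hpos : addOrderOf t ≠ 0 := by
      obtain ⟨m, hm, hmt⟩ := htors t
      exact (isOfFinAddOrder_iff_zsmul_eq_zero.2 ⟨m, hm, hmt⟩).addOrderOf_pos.ne'
    refine exists_cyclic_quotient (hq i) htors (fun χ hχ => ?_) (t₀ := d • t) ?_
    · exact hA.not_surjective_quasiCyclic (hq i) (χ ∘ₗ F.mkQ) (hχ.comp F.mkQ_surjective)
    · have hd0 : d ≠ 0 := by rintro rfl; exact hpos (by rw [hd, mul_zero])
      rw [addOrderOf_nsmul' t hd0, hd, Nat.gcd_eq_right (dvd_mul_left d _),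
        Nat.mul_div_cancel _ (Nat.pos_of_ne_zero hd0)]
  choose K u j hu huK hgen hcop using hdata
  have hij : ∀ i l, l ≠ i → u l ∈ K i := fun i l hli => hcop i _ _ (IsCoprime.pow_left
    (Nat.isCoprime_iff_coprime.2 ((Nat.coprime_primes (hq l) (hq i)).2 (hinj.ne hli)))) (hu l)
  have hsum : ∀ n i, n ≤ i → ∑ l ∈ Finset.range n, u l ∈ K i := fun n i hni =>
    sum_mem fun l hl => hij i l (by have := Finset.mem_range.1 hl; omega)
  choose x hx using fun n => F.mkQ_surjective (∑ l ∈ Finset.range n, u l)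
  have hux : ∀ i n, i < n → u i ∈ (span ℤ {x n}).map F.mkQ := by
    intro i n h
    rw [map_span, Set.image_singleton, hx]
    exact mem_span_sum_of_coprime hq hinj hu (Finset.mem_range.2 h)
  refine not_regularlyWeaklyBased_of_chain (x := x) (L := ((⨅ i, K i).comap F.mkQ : Submodule ℤ A))
    (F := F) ?_ ?_ ?_ ?_ hA
  · intro i n hin
    have : F.mkQ (x i) ∈ (span ℤ {x n}).map F.mkQ := by
      rw [hx]
      exact sum_mem fun l hl => hux l n (by have := Finset.mem_range.1 hl; omega)
    rwa [← mem_comap, comap_map_mkQ, sup_comm] at this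
  · rw [eq_top_iff]
    rintro a -
    obtain ⟨m, hm, hma⟩ := htors (F.mkQ a)
    -- An element killed by `m` lies in `K i` unless q i divides m, so finitely many `u i` correct
    -- it into every `K i`.
    have hfin : {i | ¬ IsCoprime m (q i)}.Finite := by
      refine Set.Finite.of_finite_image (m.natAbs.divisors.finite_toSet.subset ?_) hinj.injOn
      rintro _ ⟨i, hi, rfl⟩
      have hdvd : (q i : ℤ) ∣ m := by
        by_contra h
        exact hi ((Nat.prime_iff_prime_int.1 (hq i)).coprime_iff_not_dvd.2 h).symm
      exact Nat.mem_divisors.2 ⟨Int.natCast_dvd.1 hdvd, Int.natAbs_ne_zero.2 hm⟩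
    obtain ⟨n, hn⟩ := hfin.bddAbove
    choose c hc using fun i => hgen i (F.mkQ a)
    obtain ⟨b, hb, hbs⟩ : ∑ i ∈ Finset.range (n + 1), c i • u i ∈
        (span ℤ {x (n + 1)}).map F.mkQ :=
      sum_mem fun i hi => smul_mem _ _ (hux i _ (Finset.mem_range.1 hi))
    rw [← sub_add_cancel a b]
    refine add_mem (subset_span (Or.inr ?_)) (span_mono (by
      rintro _ rfl
      exact Or.inl ⟨_, rfl⟩) hb)
    change F.mkQ (a - b) ∈ ⨅ i, K i
    rw [map_sub, hbs, mem_iInf]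
    intro i
    by_cases hi : i ∈ Finset.range (n + 1)
    · rw [← Finset.add_sum_erase _ _ hi, ← sub_sub]
      exact sub_mem (hc i) (sum_mem fun l hl => smul_mem _ _ (hij i l (Finset.ne_of_mem_erase hl)))
    · refine sub_mem (hcop i m _ ?_ hma) (sum_mem fun l hl => smul_mem _ _ (hij i l ?_))
      · by_contra h
        exact hi (Finset.mem_range.2 (Nat.lt_succ_of_le (hn h)))
      · rintro rfl
        exact hi hl
  -- For i < n, x i involves only `u l` with l < n, all in `K n`, whereas `u n` is not.
  · intro n h
    have : span ℤ (x '' Set.Iio n ∪ ((⨅ i, K i).comap F.mkQ : Submodule ℤ A)) ≤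
        (K n).comap F.mkQ := by
      rw [span_le]
      rintro _ (⟨i, hi, rfl⟩ | hw)
      · change F.mkQ (x i) ∈ K n
        rw [hx]
        exact hsum i n (le_of_lt hi)
      · exact (mem_iInf _).1 hw n
    obtain ⟨a, ha⟩ := F.mkQ_surjective (u n)
    have ha' : a ∈ (K n).comap F.mkQ := this (h ▸ mem_top)
    rw [mem_comap, ha] at ha'
    exact huK n ha'
  · intro W _ hW
    obtain ⟨S, rfl⟩ := hF
    obtain ⟨T, hTW, hST⟩ := subset_span_finite_of_subset_span
      (show (S : Set A) ⊆ span ℤ W by rw [hW]; exact fun _ _ => mem_top)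
    exact ⟨T, hTW, span_le.2 hST, T.finite_toSet.inter_of_left _⟩

theorem RegularlyWeaklyBased.exists_smul_mem_fg (hA : RegularlyWeaklyBased ℤ A) :
    ∃ F : Submodule ℤ A, F.FG ∧ ∃ n : ℤ, n ≠ 0 ∧ ∀ a : A, n • a ∈ F := by
  -- The prime 2 is arbitrary: any one prime already gives nonzero multipliers into `F`, hence a
  -- torsion quotient.
  obtain ⟨F, hF, k, hk⟩ := hA.exists_fg_bound Nat.prime_two
  have htors : ∀ t : A ⧸ F, ∃ m : ℤ, m ≠ 0 ∧ m • t = 0 := by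
    intro t
    obtain ⟨a, rfl⟩ := F.mkQ_surjective t
    obtain ⟨m, hm, hmk⟩ := hk a
    refine ⟨m, by rintro rfl; exact hmk (dvd_zero _), ?_⟩
    rwa [← map_smul, ← LinearMap.mem_ker, ker_mkQ]
  have hbound : ∀ p : ℕ, ∃ k, p.Prime → ∀ t : A ⧸ F, ¬ p ^ k ∣ addOrderOf t := by
    intro p
    by_cases hp : p.Prime
    · obtain ⟨k, hk⟩ := exists_not_pow_dvd_addOrderOf hp htors fun χ hχ =>
        hA.not_surjective_quasiCyclic hp (χ ∘ₗ F.mkQ) (hχ.comp F.mkQ_surjective)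
      exact ⟨k, fun _ => hk⟩
    · exact ⟨0, fun h => absurd h hp⟩
  choose b hb using hbound
  have hfin := hA.finite_primes hF htors
  set P := hfin.toFinset with hP
  refine ⟨F, hF, (∏ p ∈ P, p ^ b p : ℕ), ?_, fun a => ?_⟩
  · rw [Nat.cast_ne_zero, Finset.prod_ne_zero_iff]
    exact fun p hp => pow_ne_zero _ ((hfin.mem_toFinset.1 hp).1.ne_zero)
  · rw [← ker_mkQ F, LinearMap.mem_ker, map_smul, ← addOrderOf_dvd_iff_zsmul_eq_zero]
    refine Int.natCast_dvd_natCast.2 ((Nat.dvd_iff_prime_pow_dvd_dvd _ _).2 fun p k hp hpk => ?_)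
    rcases Nat.eq_zero_or_pos k with rfl | hk0
    · simp
    · have hpP : p ∈ P := hfin.mem_toFinset.2 ⟨hp, F.mkQ a, (dvd_pow_self p hk0.ne').trans hpk⟩
      have hkb : k ≤ b p := by
        by_contra! h
        exact hb p hp _ ((pow_dvd_pow p h.le).trans hpk)
      exact (pow_dvd_pow p hkb).trans (Finset.dvd_prod_of_mem (fun p => p ^ b p) hpP)

/-- A group that is bounded modulo a finitely generated subgroup has a multiple that is free of
finite rank. -/
theorem exists_free_range {F : Submodule ℤ A} (hF : F.FG) {n : ℤ} (hn : n ≠ 0)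
    (h : ∀ a : A, n • a ∈ F) : ∃ N : ℤ, N ≠ 0 ∧
      Module.Free ℤ (LinearMap.range (LinearMap.lsmul ℤ A N)) ∧
      Module.Finite ℤ (LinearMap.range (LinearMap.lsmul ℤ A N)) := by
  obtain ⟨m, hm, hmtors⟩ := exists_smul_eq_zero_of_fg_torsion
    (S := F ⊓ torsion ℤ A) (FG.of_le hF inf_le_left) (by
      rintro t ⟨-, ht⟩
      obtain ⟨⟨r, hr⟩, hrt⟩ := (mem_torsion_iff _).1 ht
      exact ⟨r, nonZeroDivisors.ne_zero hr, hrt⟩)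
  -- The factor `n` moves A into `F`, and `m` then kills the torsion of `F`.
  have hle : LinearMap.range (LinearMap.lsmul ℤ A (m * n)) ≤ F := by
    rintro _ ⟨a, rfl⟩
    rw [LinearMap.lsmul_apply, mul_smul]
    exact smul_mem _ _ (h a)
  have hfg : Module.Finite ℤ (LinearMap.range (LinearMap.lsmul ℤ A (m * n))) :=
    Module.Finite.iff_fg.2 (FG.of_le hF hle)
  refine ⟨m * n, mul_ne_zero hm hn, ?_, hfg⟩
  have : Module.IsTorsionFree ℤ (LinearMap.range (LinearMap.lsmul ℤ A (m * n))) := by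
    refine Module.isTorsionFree_iff_smul_eq_zero.2 fun r x hrx => or_iff_not_imp_left.2 fun hr => ?_
    obtain ⟨_, a, rfl⟩ := x
    have hra : r • (m * n) • a = 0 := congrArg Subtype.val hrx
    refine Subtype.ext ?_
    change (m * n) • a = 0
    rw [mul_smul]
    refine hmtors _ ⟨h a, (mem_torsion_iff _).2
      ⟨⟨r * m, mem_nonZeroDivisors_of_ne_zero (mul_ne_zero hr hm)⟩, ?_⟩⟩
    change (r * m) • n • a = 0
    rw [mul_smul, smul_smul m, hra]
  exact Module.free_of_finite_type_torsion_free'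

end Torsion
end WeaklyBased

theorem corollary4p8 {A : Type u} [AddCommGroup A]
    (hA : WeaklyBased.RegularlyWeaklyBased ℤ A) :
    ∃ (F B : Type u) (_ : AddCommGroup F) (_ : AddCommGroup B),
      Module.Free ℤ F ∧ Module.Finite ℤ F ∧
      (∃ n : ℕ, 0 < n ∧ ∀ b : B, n • b = 0) ∧
      Nonempty (A ≃+ F × B) := by
  obtain ⟨F, hF, n, hn, hnF⟩ := hA.exists_smul_mem_fg
  obtain ⟨N, hN, hfree, hfin⟩ := WeaklyBased.exists_free_range hF hn hnF
  set f := LinearMap.lsmul ℤ A N with hf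
  -- NA is free, so multiplication by `N` onto it has a section; its kernel is the bounded summand.
  obtain ⟨g, hg⟩ := Module.projective_lifting_property f.rangeRestrict LinearMap.id
    f.surjective_rangeRestrict
  refine ⟨LinearMap.range f, LinearMap.ker f, inferInstance, inferInstance, hfree, hfin,
    ⟨N.natAbs, Int.natAbs_pos.2 hN, fun b => ?_⟩, ⟨?_⟩⟩
  · have : N • b = 0 := Subtype.ext b.2
    exact natAbs_nsmul_eq_zero.2 this
  · exact ((lequivProdOfRightSplitExact (LinearMap.ker f).injective_subtype
      (by rw [Submodule.range_subtype, LinearMap.ker_rangeRestrict]) hg).symm.trans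
      (LinearEquiv.prodComm ℤ _ _)).toAddEquiv
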